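/- Let $\phi \in L^{\infty}(\mathbb{R})$ be complex-valued and let $\hat\phi$ be its Poisson integral on the right half plane $\mathbb{C}^+ = \{z \in \mathbb{C} : \operatorname{Re} z > 0\}$, \[ \hat\phi(x+iy) = \frac{1}{\pi}\int_{-\infty}^{\infty} \phi(t)\, \frac{x}{x^2+(y-t)^2}\, dt \qquad (x>0,\ y\in\mathbb{R}). \] Then, for every $y \in \mathbb{R}$, the limit \[ \lim_{x \to 0^+} \hat\phi(x+iy) \] exists in $\mathbb{C}$ if and only if the limit \[ \lim_{\theta \to 0} \frac{1}{2\theta}\int_{y-\theta}^{y+\theta} \phi(t)\, dt \] exists in $\mathbb{C}$. -/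

import Mathlib

/-- The Poisson integral of `φ : ℝ → ℂ` at the point `z = x + iy` of the right half plane `x > 0`:
`(1/π) ∫ φ(t) x / (x² + (y - t)²) dt`. The integrand is integrable for `φ ∈ L^∞(ℝ)` and `x > 0`. -/
noncomputable def poissonIntegral (φ : ℝ → ℂ) (z : ℂ) : ℂ :=
  (1 / (Real.pi : ℂ)) *
    ∫ t : ℝ, φ t * ((z.re / (z.re ^ 2 + (z.im - t) ^ 2) : ℝ) : ℂ)

/-
The Poisson averages of `φ` at `y` are the averages of `χ(t) = φ(y + t) - c` against the dilates
of `s ↦ (1 + s²)⁻¹`, and the interval means those against the dilates of the indicator of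
`[-1, 1]`; so for a fixed `c` it suffices to see that one kernel is null for `χ` if and only if the
other is. Since `χ` is bounded, the null kernels form a closed subspace of `L¹(ℝ)`, invariant under
dilations.

If `u = (1 + s²)⁻¹` is null, so are its dilates `u / (1 + b u)`, hence all powers of `u`, hence by
Weierstrass `u k(u)` for every continuous `k`, hence the indicator of `{u ≥ 1/2} = [-1, 1]`. This
is Karamata's argument for Tauberian theorems. Conversely the layer-cake formula writes `u` as a
superposition of indicators of intervals centred at `0`.
-/

open MeasureTheory Filter Topology Set

variable {E : Type*} [NormedAddCommGroup E]

lemma quasiMeasurePreserving_const_mul {x : ℝ} (hx : x ≠ 0) :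
    Measure.QuasiMeasurePreserving (x * ·) volume volume :=
  ⟨measurable_const_mul x, by
    rw [Real.map_volume_mul_left hx]
    exact Measure.smul_absolutelyContinuous⟩

section Dilation

variable {χ : ℝ → E} {x : ℝ}

lemma aestronglyMeasurable_comp_const_mul (hχ : AEStronglyMeasurable χ) (hx : x ≠ 0) :
    AEStronglyMeasurable fun s => χ (x * s) :=
  hχ.comp_quasiMeasurePreserving (quasiMeasurePreserving_const_mul hx)

lemma ae_norm_comp_const_mul_le (hχ : MemLp χ ⊤) (hx : x ≠ 0) :
    ∀ᵐ s, ‖χ (x * s)‖ ≤ lpNorm χ ⊤ volume :=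
  (quasiMeasurePreserving_const_mul hx).ae (ae_le_lpNorm_exponent_top hχ)

variable [NormedSpace ℝ E] {f : ℝ → ℝ}

lemma integrable_smul_comp_const_mul (hχ : MemLp χ ⊤) (hf : Integrable f) (hx : x ≠ 0) :
    Integrable fun s => f s • χ (x * s) :=
  hf.smul_bdd _ (aestronglyMeasurable_comp_const_mul hχ.1 hx) (ae_norm_comp_const_mul_le hχ hx)

lemma norm_integral_smul_comp_const_mul_le (hχ : MemLp χ ⊤) (hf : Integrable f) (hx : x ≠ 0) :
    ‖∫ s, f s • χ (x * s)‖ ≤ (∫ s, |f s|) * lpNorm χ ⊤ volume := by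
  rw [← integral_mul_const]
  refine norm_integral_le_of_norm_le (hf.abs.mul_const _) ?_
  filter_upwards [ae_norm_comp_const_mul_le hχ hx] with s hs
  rw [norm_smul, Real.norm_eq_abs]
  gcongr

end Dilation

/-- A kernel `f ∈ L¹(ℝ)` is null for `χ` if the averages `x⁻¹ ∫ f (t / x) χ(t) dt` of `χ` against
the dilates of `f` tend to `0` as `x → 0⁺`; they are written here after the substitution
`t = x s`. -/
def IsNullKernel [NormedSpace ℝ E] (χ : ℝ → E) (f : ℝ → ℝ) : Prop :=
  Integrable f ∧ Tendsto (fun x : ℝ => ∫ s, f s • χ (x * s)) (𝓝[>] 0) (𝓝 0)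

namespace IsNullKernel

variable [NormedSpace ℝ E] {χ : ℝ → E} {f g : ℝ → ℝ}

lemma zero : IsNullKernel χ 0 :=
  ⟨integrable_zero _ _ _, by simp⟩

lemma add (hχ : MemLp χ ⊤) (hf : IsNullKernel χ f) (hg : IsNullKernel χ g) :
    IsNullKernel χ fun s => f s + g s := by
  refine ⟨hf.1.add hg.1, ?_⟩
  have h := hf.2.add hg.2
  rw [add_zero] at h
  refine h.congr' ?_
  filter_upwards [self_mem_nhdsWithin] with x (hx : 0 < x)
  simp only [add_smul]
  exact (integral_add (integrable_smul_comp_const_mul hχ hf.1 hx.ne')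
    (integrable_smul_comp_const_mul hχ hg.1 hx.ne')).symm

lemma const_mul (r : ℝ) (hf : IsNullKernel χ f) : IsNullKernel χ fun s => r * f s := by
  refine ⟨hf.1.const_mul r, ?_⟩
  simpa only [mul_smul, integral_smul, smul_zero] using hf.2.const_smul r

lemma comp_const_mul {l : ℝ} (hl : 0 < l) (hf : IsNullKernel χ f) :
    IsNullKernel χ fun s => f (l * s) := by
  refine ⟨hf.1.comp_mul_left' hl.ne', ?_⟩
  have hdil : Tendsto (l⁻¹ * ·) (𝓝[>] 0) (𝓝[>] 0) := by
    simpa only [comap_mulLeft_nhdsGT_zero (inv_pos.2 hl)] using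
      tendsto_comap (f := (l⁻¹ * ·)) (x := 𝓝[>] (0 : ℝ))
  have h := (hf.2.comp hdil).const_smul l⁻¹
  rw [smul_zero] at h
  refine h.congr fun x => ?_
  have hsubst := Measure.integral_comp_mul_left (fun u => f u • χ (l⁻¹ * x * u)) l
  rw [abs_of_pos (inv_pos.2 hl)] at hsubst
  rw [Function.comp_apply, ← hsubst]
  congr! 3 with s
  field_simp

lemma of_tendsto_integral_abs_sub (hχ : MemLp χ ⊤) {F : ℕ → ℝ → ℝ}
    (hF : ∀ n, IsNullKernel χ (F n)) (hf : Integrable f)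
    (hlim : Tendsto (fun n => ∫ s, |F n s - f s|) atTop (𝓝 0)) : IsNullKernel χ f := by
  refine ⟨hf, ?_⟩
  have hunif : TendstoUniformlyOn (fun n x => ∫ s, F n s • χ (x * s))
      (fun x => ∫ s, f s • χ (x * s)) atTop (Ioi 0) := by
    rw [Metric.tendstoUniformlyOn_iff]
    intro ε hε
    have hbound := hlim.mul_const (lpNorm χ ⊤ volume)
    rw [zero_mul] at hbound
    filter_upwards [hbound.eventually_lt_const hε] with n hn x (hx : 0 < x)
    rw [dist_comm, dist_eq_norm,
      ← integral_sub (integrable_smul_comp_const_mul hχ (hF n).1 hx.ne')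
        (integrable_smul_comp_const_mul hχ hf hx.ne')]
    simp only [← sub_smul]
    exact (norm_integral_smul_comp_const_mul_le hχ ((hF n).1.sub hf) hx.ne').trans_lt hn
  exact (hunif.tendstoUniformlyOnFilter.mono_right inf_le_right).tendsto_of_eventually_tendsto
    (Eventually.of_forall fun n => (hF n).2) tendsto_const_nhds

lemma of_tendsto (hχ : MemLp χ ⊤) {F : ℕ → ℝ → ℝ} (hF : ∀ n, IsNullKernel χ (F n))
    (hg : Integrable g) (hFg : ∀ n s, |F n s| ≤ g s)
    (hlim : ∀ s, Tendsto (fun n => F n s) atTop (𝓝 (f s))) : IsNullKernel χ f := by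
  have hfg : ∀ s, |f s| ≤ g s := fun s => le_of_tendsto' (hlim s).abs fun n => hFg n s
  have hfm : AEStronglyMeasurable f :=
    aestronglyMeasurable_of_tendsto_ae atTop (fun n => (hF n).1.1) (ae_of_all _ hlim)
  refine of_tendsto_integral_abs_sub hχ hF (hg.mono' hfm (ae_of_all _ hfg)) ?_
  have hdom : ∀ n s, ‖|F n s - f s|‖ ≤ 2 * g s := fun n s => by
    rw [Real.norm_eq_abs, abs_abs]
    linarith [abs_sub (F n s) (f s), hFg n s, hfg s]
  have hzero : ∀ s, Tendsto (fun n => |F n s - f s|) atTop (𝓝 0) := fun s => by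
    simpa only [sub_self, abs_zero] using ((hlim s).sub_const (f s)).abs
  rw [← integral_zero ℝ ℝ]
  exact tendsto_integral_of_dominated_convergence (fun s => 2 * g s)
    (fun n => ((hF n).1.1.sub hfm).norm) (hg.const_mul 2) (fun n => ae_of_all _ (hdom n))
    (ae_of_all _ hzero)

lemma integral [CompleteSpace E] (hχ : MemLp χ ⊤) {α : Type*} [MeasurableSpace α]
    {μ : Measure α} [SFinite μ] {K : α → ℝ → ℝ}
    (hK : Integrable (Function.uncurry K) (μ.prod volume)) (h : ∀ᵐ a ∂μ, IsNullKernel χ (K a)) :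
    IsNullKernel χ fun s => ∫ a, K a s ∂μ := by
  refine ⟨hK.integral_prod_right, ?_⟩
  have hswap : ∀ x : ℝ, x ≠ 0 →
      ∫ a, (∫ s, K a s • χ (x * s)) ∂μ = ∫ s, (∫ a, K a s ∂μ) • χ (x * s) := by
    intro x hx
    have hint : Integrable (fun p : α × ℝ => K p.1 p.2 • χ (x * p.2)) (μ.prod volume) :=
      hK.smul_bdd _ (aestronglyMeasurable_comp_const_mul hχ.1 hx).comp_snd
        (Measure.quasiMeasurePreserving_snd.ae (ae_norm_comp_const_mul_le hχ hx))
    rw [integral_integral_swap hint]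
    simp only [integral_smul_const]
  have hlim : Tendsto (fun x : ℝ => ∫ a, (∫ s, K a s • χ (x * s)) ∂μ) (𝓝[>] 0)
      (𝓝 (∫ _, (0 : E) ∂μ)) := by
    refine tendsto_integral_filter_of_dominated_convergence
      (fun a => (∫ s, |K a s|) * lpNorm χ ⊤ volume) ?_ ?_
      (hK.integral_norm_prod_left.mul_const _) (h.mono fun a ha => ha.2)
    · filter_upwards [self_mem_nhdsWithin] with x (hx : 0 < x)
      exact (hK.1.smul
        (aestronglyMeasurable_comp_const_mul hχ.1 hx.ne').comp_snd).integral_prod_right'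
    · filter_upwards [self_mem_nhdsWithin] with x (hx : 0 < x)
      exact h.mono fun a ha => norm_integral_smul_comp_const_mul_le hχ ha.1 hx.ne'
  rw [integral_zero] at hlim
  refine hlim.congr' ?_
  filter_upwards [self_mem_nhdsWithin] with x (hx : 0 < x)
  exact hswap x hx.ne'

/-- Layer cake: `f s = ∫₀^∞ 1_{a ≤ f s} da`. -/
lemma of_superlevel [CompleteSpace E] (hχ : MemLp χ ⊤) (hfm : Measurable f) (hf : Integrable f)
    (hf0 : ∀ s, 0 ≤ f s) (h : ∀ᵐ a, 0 < a → IsNullKernel χ ({s | a ≤ f s}.indicator 1)) :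
    IsNullKernel χ f := by
  have hcake : ∀ s, ∫ a in Ioi 0, {s | a ≤ f s}.indicator (1 : ℝ → ℝ) s = f s := by
    intro s
    change ∫ a in Ioi 0, (Iic (f s)).indicator (1 : ℝ → ℝ) a = f s
    rw [integral_indicator_one measurableSet_Iic, measureReal_restrict_apply measurableSet_Iic,
      inter_comm, Ioi_inter_Iic, Real.volume_real_Ioc_of_le (hf0 s), sub_zero]
  have hmeas : MeasurableSet {p : ℝ × ℝ | p.1 ≤ f p.2} :=
    measurableSet_le measurable_fst (hfm.comp measurable_snd)
  have hint : Integrable (Function.uncurry fun a => {s | a ≤ f s}.indicator (1 : ℝ → ℝ))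
      ((volume.restrict (Ioi 0)).prod volume) := by
    refine (integrable_prod_iff' ?_).2 ⟨ae_of_all _ fun s => ?_, ?_⟩
    · exact (measurable_one.indicator hmeas).aestronglyMeasurable
    · change IntegrableOn ((Iic (f s)).indicator 1) (Ioi 0)
      rw [integrableOn_indicator_iff measurableSet_Iic, inter_comm, Ioi_inter_Iic]
      exact integrableOn_const measure_Ioc_lt_top.ne
    · refine hf.congr (ae_of_all _ fun s => ?_)
      simp only [Function.uncurry_apply_pair, norm_indicator_eq_indicator_norm, Pi.one_apply,
        norm_one]
      exact (hcake s).symm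
  have := integral hχ hint ((ae_restrict_iff' measurableSet_Ioi).2 h)
  simpa only [hcake] using this

/-- The powers of `f` are reached by induction through
`f ^ (n + 2) / (1 + b f) = b⁻¹ (f ^ (n + 1) - f ^ (n + 1) / (1 + b f))` for `b > 0`, and letting
`b → 0⁺`. -/
lemma pow_div_one_add_mul (hχ : MemLp χ ⊤) (hf01 : ∀ s, f s ∈ Icc (0 : ℝ) 1)
    (h : ∀ b, 0 ≤ b → IsNullKernel χ fun s => f s / (1 + b * f s)) (n : ℕ) :
    ∀ b, 0 ≤ b → IsNullKernel χ fun s => f s ^ (n + 1) / (1 + b * f s) := by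
  have hf0 : ∀ s, 0 ≤ f s := fun s => (hf01 s).1
  have hf : IsNullKernel χ f := by simpa using h 0 le_rfl
  induction n with
  | zero => simpa using h
  | succ n ih =>
    have hpow : IsNullKernel χ fun s => f s ^ (n + 1) := by simpa using ih 0 le_rfl
    have hpos : ∀ b, 0 < b → IsNullKernel χ fun s => f s ^ (n + 2) / (1 + b * f s) := by
      intro b hb
      convert (hpow.add hχ ((ih b hb.le).const_mul (-1))).const_mul b⁻¹ using 2 with s
      have : 1 + b * f s ≠ 0 := by have := hf0 s; positivity
      field_simp
      ring
    intro b hb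
    rcases hb.eq_or_lt with rfl | hb
    · refine of_tendsto hχ (fun m : ℕ => hpos (1 / ((m : ℝ) + 1)) (by positivity)) hf.1
        (fun m s => ?_) fun s => ?_
      · have := hf0 s
        rw [abs_of_nonneg (by positivity)]
        calc f s ^ (n + 2) / (1 + 1 / ((m : ℝ) + 1) * f s) ≤ f s ^ (n + 2) :=
              div_le_self (by positivity) (le_add_of_nonneg_right (by positivity))
          _ ≤ f s := pow_le_of_le_one this (hf01 s).2 (by lia)
      · exact tendsto_const_nhds.div
          ((tendsto_one_div_add_atTop_nhds_zero_nat.mul_const _).const_add 1) (by simp)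
    · exact hpos b hb

lemma mul_polynomial (hχ : MemLp χ ⊤) (hpow : ∀ n : ℕ, IsNullKernel χ fun s => f s ^ (n + 1))
    (p : Polynomial ℝ) : IsNullKernel χ fun s => f s * p.eval (f s) := by
  induction p using Polynomial.induction_on' with
  | add p q hp hq => simpa only [Polynomial.eval_add, mul_add] using hp.add hχ hq
  | monomial n r =>
    convert (hpow n).const_mul r using 2 with s
    rw [Polynomial.eval_monomial, pow_succ']
    ring

lemma mul_continuousOn (hχ : MemLp χ ⊤) (hf01 : ∀ s, f s ∈ Icc (0 : ℝ) 1)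
    (hpow : ∀ n : ℕ, IsNullKernel χ fun s => f s ^ (n + 1)) {k : ℝ → ℝ}
    (hk : ContinuousOn k (Icc 0 1)) : IsNullKernel χ fun s => f s * k (f s) := by
  obtain ⟨C, hC⟩ := isCompact_Icc.exists_bound_of_continuousOn hk
  choose p hp using fun m : ℕ => exists_polynomial_near_of_continuousOn 0 1 k hk
    (1 / ((m : ℝ) + 1)) (by positivity)
  have hf : Integrable f := by simpa using (hpow 0).1
  refine of_tendsto hχ (fun m => mul_polynomial hχ hpow (p m)) (hf.const_mul (C + 1))
    (fun m s => ?_) fun s => ?_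
  · have hpC : |(p m).eval (f s)| ≤ C + 1 := by
      have hk_le : |k (f s)| ≤ C := hC _ (hf01 s)
      have hε : 1 / ((m : ℝ) + 1) ≤ 1 := (div_le_one (by positivity)).2 (by simp)
      linarith [hp m _ (hf01 s), abs_sub_abs_le_abs_sub ((p m).eval (f s)) (k (f s))]
    rw [abs_mul, abs_of_nonneg (hf01 s).1, mul_comm]
    exact mul_le_mul_of_nonneg_right hpC (hf01 s).1
  · refine Tendsto.const_mul _ (tendsto_iff_dist_tendsto_zero.2 ?_)
    exact squeeze_zero (fun _ => dist_nonneg) (fun m => (hp m _ (hf01 s)).le)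
      tendsto_one_div_add_atTop_nhds_zero_nat

lemma indicator_superlevel (hχ : MemLp χ ⊤) (hf01 : ∀ s, f s ∈ Icc (0 : ℝ) 1)
    (hpow : ∀ n : ℕ, IsNullKernel χ fun s => f s ^ (n + 1)) {a : ℝ} (ha : 0 < a) :
    IsNullKernel χ ({s | a ≤ f s}.indicator 1) := by
  have hδ : ∀ m : ℕ, 0 < 1 / ((m : ℝ) + 1) := fun m => by positivity
  let T : ℕ → ℝ → ℝ := fun m u => thickenedIndicator (hδ m) (Ici a) u
  have hT_cont : ∀ m, Continuous (T m) := fun m =>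
    NNReal.continuous_coe.comp (thickenedIndicator (hδ m) (Ici a)).continuous
  have hT_lim : ∀ u, Tendsto (T · u) atTop (𝓝 ((Ici a).indicator 1 u)) := fun u => by
    have := NNReal.tendsto_coe.2 <| tendsto_pi_nhds.1
      (thickenedIndicator_tendsto_indicator_closure hδ
        tendsto_one_div_add_atTop_nhds_zero_nat (Ici a)) u
    rw [isClosed_Ici.closure_eq] at this
    convert this using 2
    by_cases hu : u ∈ Ici a <;> simp [hu]
  have hmax : ∀ u, 0 < max u a := fun u => lt_max_of_lt_right ha
  have hf : Integrable f := by simpa using (hpow 0).1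
  refine of_tendsto hχ (fun m => mul_continuousOn hχ hf01 hpow (k := fun u => T m u / max u a)
    (Continuous.div (hT_cont m) (by fun_prop) fun u => (hmax u).ne').continuousOn)
    (hf.const_mul a⁻¹) (fun m s => ?_) fun s => ?_
  · have hT0 : 0 ≤ T m (f s) := NNReal.coe_nonneg _
    have hT1 : T m (f s) ≤ 1 := thickenedIndicator_le_one (hδ m) _ _
    rw [abs_of_nonneg (mul_nonneg (hf01 s).1 (div_nonneg hT0 (hmax _).le)), mul_comm,
      inv_eq_one_div]
    gcongr
    · exact (hf01 s).1
    · exact le_max_right _ _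
  · convert ((hT_lim (f s)).div_const (max (f s) a)).const_mul (f s) using 2
    by_cases hs : a ≤ f s
    · have := ha.trans_le hs
      simp [hs, this.ne']
    · simp [hs]

lemma inv_one_add_sq_mem_Icc (s : ℝ) : (1 + s ^ 2)⁻¹ ∈ Icc (0 : ℝ) 1 :=
  ⟨by positivity, inv_le_one_of_one_le₀ (le_add_of_nonneg_right (sq_nonneg s))⟩

lemma le_inv_one_add_sq_iff {a : ℝ} (ha : 0 < a) {s : ℝ} :
    a ≤ (1 + s ^ 2)⁻¹ ↔ s ^ 2 ≤ a⁻¹ - 1 := by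
  rw [le_inv_comm₀ ha (by positivity), le_sub_iff_add_le']

lemma div_one_add_mul_of_inv_one_add_sq (h : IsNullKernel χ fun s => (1 + s ^ 2)⁻¹) {b : ℝ}
    (hb : 0 ≤ b) : IsNullKernel χ fun s => (1 + s ^ 2)⁻¹ / (1 + b * (1 + s ^ 2)⁻¹) := by
  have hb1 : 0 < 1 + b := by positivity
  convert (h.comp_const_mul (inv_pos.2 (Real.sqrt_pos.2 hb1))).const_mul (1 + b)⁻¹ using 2 with s
  rw [mul_pow, inv_pow, Real.sq_sqrt hb1.le]
  field_simp
  ring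

lemma indicator_Icc_of_inv_one_add_sq (hχ : MemLp χ ⊤)
    (h : IsNullKernel χ fun s => (1 + s ^ 2)⁻¹) : IsNullKernel χ ((Icc (-1) 1).indicator 1) := by
  have hpow (n : ℕ) : IsNullKernel χ fun s => (1 + s ^ 2)⁻¹ ^ (n + 1) := by
    simpa using pow_div_one_add_mul hχ inv_one_add_sq_mem_Icc
      (fun b => h.div_one_add_mul_of_inv_one_add_sq) n 0 le_rfl
  convert indicator_superlevel hχ inv_one_add_sq_mem_Icc hpow (a := 2⁻¹) (by positivity)
  ext s
  rw [mem_ofPred_eq, le_inv_one_add_sq_iff (by positivity), mem_Icc, ← abs_le,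
    ← sq_le_one_iff_abs_le_one]
  norm_num

lemma indicator_Icc_neg_self (h : IsNullKernel χ ((Icc (-1) 1).indicator 1)) {l : ℝ} (hl : 0 < l) :
    IsNullKernel χ ((Icc (-l) l).indicator 1) := by
  convert h.comp_const_mul (inv_pos.2 hl) using 2 with s
  have : s ∈ Icc (-l) l ↔ l⁻¹ * s ∈ Icc (-1 : ℝ) 1 := by
    rw [mem_Icc, mem_Icc, ← abs_le, ← abs_le, abs_mul, abs_of_pos (inv_pos.2 hl),
      inv_mul_le_iff₀ hl, mul_one]
  simp only [indicator, this, Pi.one_apply]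

lemma inv_one_add_sq_of_indicator_Icc [CompleteSpace E] (hχ : MemLp χ ⊤)
    (h : IsNullKernel χ ((Icc (-1) 1).indicator 1)) : IsNullKernel χ fun s => (1 + s ^ 2)⁻¹ := by
  refine of_superlevel hχ (by fun_prop) integrable_inv_one_add_sq
    (fun s => (inv_one_add_sq_mem_Icc s).1) ?_
  filter_upwards [Measure.ae_ne volume 1] with a ha1 ha0
  rcases ha1.lt_or_gt with ha | ha
  · have hr : 0 < a⁻¹ - 1 := sub_pos.2 ((one_lt_inv₀ ha0).2 ha)
    convert h.indicator_Icc_neg_self (Real.sqrt_pos.2 hr) using 2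
    ext s
    rw [mem_ofPred_eq, le_inv_one_add_sq_iff ha0, mem_Icc, ← Real.sq_le hr.le]
  · have hempty : {s : ℝ | a ≤ (1 + s ^ 2)⁻¹} = ∅ :=
      eq_empty_of_forall_notMem fun s hs => (hs.trans (inv_one_add_sq_mem_Icc s).2).not_gt ha
    rw [hempty, indicator_empty']
    exact zero

end IsNullKernel

section Averages

lemma tendsto_nhdsNE_zero_iff_of_even {α : Type*} {F : ℝ → α} (hF : Function.Even F)
    {l : Filter α} : Tendsto F (𝓝[≠] 0) l ↔ Tendsto F (𝓝[>] 0) l := by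
  rw [← Iio_union_Ioi, nhdsWithin_union, tendsto_sup, and_iff_right_iff_imp]
  intro h
  have hneg : Tendsto (fun θ : ℝ => -θ) (𝓝[<] 0) (𝓝[>] 0) := by
    simpa using tendsto_neg_nhdsLT (a := (0 : ℝ))
  exact (h.comp hneg).congr hF

variable [NormedSpace ℝ E]

lemma even_intervalAverage (φ : ℝ → E) (y : ℝ) :
    Function.Even fun θ : ℝ => (2 * θ)⁻¹ • ∫ t in (y - θ)..(y + θ), φ t := fun θ => by
  beta_reduce
  rw [sub_neg_eq_add, ← sub_eq_add_neg, intervalIntegral.integral_symm, mul_neg, inv_neg,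
    neg_smul_neg]

lemma integral_comp_add_const_mul (F : ℝ → E) (y : ℝ) {x : ℝ} (hx : 0 < x) :
    ∫ s, F (y + x * s) = x⁻¹ • ∫ t, F t := by
  rw [Measure.integral_comp_mul_left (fun u => F (y + u)) x, abs_of_pos (inv_pos.2 hx),
    integral_add_left_eq_self]

lemma integral_poissonKernel_smul (φ : ℝ → E) (y : ℝ) {x : ℝ} (hx : 0 < x) :
    ∫ t, (x / (x ^ 2 + (y - t) ^ 2)) • φ t = ∫ s, (1 + s ^ 2)⁻¹ • φ (y + x * s) := by
  have hsubst := integral_comp_add_const_mul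
    (fun t => (x / (x ^ 2 + (y - t) ^ 2)) • φ t) y hx
  rw [eq_inv_smul_iff₀ hx.ne', ← integral_smul] at hsubst
  rw [← hsubst]
  congr! 2 with s
  rw [smul_smul]
  congr 1
  field_simp
  ring

lemma intervalAverage_eq_integral_indicator_smul (φ : ℝ → E) (y : ℝ) {x : ℝ} (hx : 0 < x) :
    (2 * x)⁻¹ • ∫ t in (y - x)..(y + x), φ t =
      (2 : ℝ)⁻¹ • ∫ s, (Icc (-1) 1).indicator (1 : ℝ → ℝ) s • φ (y + x * s) := by
  have hind (s : ℝ) : (Icc (-1) 1).indicator (1 : ℝ → ℝ) s • φ (y + x * s) =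
      (Icc (-1) 1).indicator (fun s => φ (y + x * s)) s := by
    simp [indicator_apply]
  simp only [hind]
  rw [integral_indicator measurableSet_Icc, integral_Icc_eq_integral_Ioc,
    ← intervalIntegral.integral_of_le (by norm_num),
    intervalIntegral.integral_comp_add_mul φ hx.ne' y, mul_neg_one, mul_one, ← sub_eq_add_neg,
    smul_smul, mul_inv]

variable [CompleteSpace E] {φ : ℝ → E}

lemma isNullKernel_sub_const_iff (hφ : MemLp φ ⊤) (y : ℝ) (c : E) {f : ℝ → ℝ}
    (hf : Integrable f) (hf0 : ∫ s, f s ≠ 0) :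
    IsNullKernel (fun t => φ (y + t) - c) f ↔
      Tendsto (fun x => (∫ s, f s)⁻¹ • ∫ s, f s • φ (y + x * s)) (𝓝[>] 0) (𝓝 c) := by
  have hφy : MemLp (fun t => φ (y + t)) ⊤ :=
    hφ.comp_measurePreserving (measurePreserving_add_left volume y)
  have hsub : ∀ᶠ x in 𝓝[>] (0 : ℝ), ∫ s, f s • (φ (y + x * s) - c) =
      (∫ s, f s) • ((∫ s, f s)⁻¹ • (∫ s, f s • φ (y + x * s)) - c) := by
    filter_upwards [self_mem_nhdsWithin] with x (hx : 0 < x)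
    simp only [smul_sub]
    rw [integral_sub (integrable_smul_comp_const_mul hφy hf hx.ne') (hf.smul_const c),
      integral_smul_const, smul_inv_smul₀ hf0]
  rw [IsNullKernel, and_iff_right hf, tendsto_congr' hsub, ← tendsto_sub_nhds_zero_iff (x := c)]
  simpa only [smul_zero] using tendsto_const_smul_iff₀ hf0 (a := (0 : E))

lemma isNullKernel_inv_one_add_sq_iff_tendsto (hφ : MemLp φ ⊤) (y : ℝ) (c : E) :
    IsNullKernel (fun t => φ (y + t) - c) (fun s => (1 + s ^ 2)⁻¹) ↔
      Tendsto (fun x : ℝ => Real.pi⁻¹ • ∫ t, (x / (x ^ 2 + (y - t) ^ 2)) • φ t)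
        (𝓝[>] 0) (𝓝 c) := by
  rw [isNullKernel_sub_const_iff hφ y c integrable_inv_one_add_sq
    (by simp [Real.pi_ne_zero]), integral_univ_inv_one_add_sq]
  refine tendsto_congr' ?_
  filter_upwards [self_mem_nhdsWithin] with x hx
  rw [integral_poissonKernel_smul φ y hx]

lemma isNullKernel_indicator_Icc_iff_tendsto (hφ : MemLp φ ⊤) (y : ℝ) (c : E) :
    IsNullKernel (fun t => φ (y + t) - c) ((Icc (-1) 1).indicator 1) ↔
      Tendsto (fun θ : ℝ => (2 * θ)⁻¹ • ∫ t in (y - θ)..(y + θ), φ t) (𝓝[≠] 0) (𝓝 c) := by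
  have hint : Integrable ((Icc (-1 : ℝ) 1).indicator (1 : ℝ → ℝ)) :=
    (integrable_indicator_iff measurableSet_Icc).2 (integrableOn_const measure_Icc_lt_top.ne)
  have hmass : ∫ s, (Icc (-1 : ℝ) 1).indicator (1 : ℝ → ℝ) s = 2 := by
    rw [integral_indicator_one measurableSet_Icc, Real.volume_real_Icc_of_le (by norm_num)]
    norm_num
  rw [isNullKernel_sub_const_iff hφ y c hint (by rw [hmass]; exact two_ne_zero), hmass,
    tendsto_nhdsNE_zero_iff_of_even (even_intervalAverage φ y)]
  refine tendsto_congr' ?_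
  filter_upwards [self_mem_nhdsWithin] with θ hθ
  rw [intervalAverage_eq_integral_indicator_smul φ y hθ]

theorem theorem4p7_general (hφ : MemLp φ ⊤) (y : ℝ) (c : E) :
    Tendsto (fun x : ℝ => Real.pi⁻¹ • ∫ t, (x / (x ^ 2 + (y - t) ^ 2)) • φ t)
        (𝓝[>] 0) (𝓝 c) ↔
      Tendsto (fun θ : ℝ => (2 * θ)⁻¹ • ∫ t in (y - θ)..(y + θ), φ t) (𝓝[≠] 0) (𝓝 c) := by
  have hχ : MemLp (fun t => φ (y + t) - c) ⊤ :=
    (hφ.comp_measurePreserving (measurePreserving_add_left volume y)).sub (memLp_top_const c)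
  rw [← isNullKernel_inv_one_add_sq_iff_tendsto hφ, ← isNullKernel_indicator_Icc_iff_tendsto hφ]
  exact ⟨fun h => h.indicator_Icc_of_inv_one_add_sq hχ,
    fun h => h.inv_one_add_sq_of_indicator_Icc hχ⟩

end Averages

lemma poissonIntegral_add_mul_I (φ : ℝ → ℂ) (x y : ℝ) :
    poissonIntegral φ (x + y * Complex.I) =
      Real.pi⁻¹ • ∫ t, (x / (x ^ 2 + (y - t) ^ 2)) • φ t := by
  simp [poissonIntegral, Complex.real_smul, mul_comm (φ _)]

lemma one_div_two_mul_mul_eq_smul (θ : ℝ) (z : ℂ) : 1 / (2 * (θ : ℂ)) * z = (2 * θ)⁻¹ • z := by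
  simp [Complex.real_smul]

theorem theorem4p7 (φ : ℝ → ℂ) (hφ : MeasureTheory.MemLp φ ⊤ MeasureTheory.volume) (y : ℝ) :
    (∃ a : ℂ, Filter.Tendsto
        (fun x : ℝ => poissonIntegral φ ((x : ℂ) + (y : ℂ) * Complex.I))
        (nhdsWithin 0 (Set.Ioi 0)) (nhds a)) ↔
      (∃ b : ℂ, Filter.Tendsto
        (fun θ : ℝ => (1 / (2 * (θ : ℂ))) * ∫ t in (y - θ)..(y + θ), φ t)
        (nhdsWithin 0 {0}ᶜ) (nhds b)) := by
  simp only [poissonIntegral_add_mul_I, one_div_two_mul_mul_eq_smul]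
  exact exists_congr (theorem4p7_general hφ y)
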